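/- Let $x\neq 1$ be a root of unity and let $a\in\mathbb{C}\setminus\mathbb{Z}$. Write $$\mathrm{Li}_1(y;c)=\sum_{n=1}^{\infty}\frac{y^n}{n+c-1}$$ for the cyclotomic Hurwitz zeta function (with $c\notin\{0,-1,-2,\dots\}$), and let $\binom{2s}{s}=\Gamma(2s+1)/\Gamma(s+1)^2$, where $1/\binom{2s}{s}$ is interpreted as $0$ when $s\notin\mathbb{Z}$ and $2s$ is a negative integer. Then the series defining $\mathrm{Li}_1(x^{-1};a)$ and $\mathrm{Li}_1(x;1-a)$ converge, the bilateral series below converges (its partial sums over $M\le n\le N$ have a limit as $M\to-\infty$ and $N\to+\infty$ independently), and $$\sum_{n=-\infty}^{\infty}\frac{4^{n+a}}{(n+a)\binom{2n+2a}{n+a}}\,x^{-n}=\frac{x\,\mathrm{Li}_1(x^{-1};a)-\mathrm{Li}_1(x;1-a)}{\sqrt{1-x}},$$ where $4^{n+a}=e^{(n+a)\log 4}$ and $\sqrt{\cdot}$ is the principal square root. -/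

import Mathlib

noncomputable section

namespace CPAS

/-- The generalized binomial coefficient `Γ(u+1) / (Γ(v+1) Γ(u-v+1))`, meaningful for
`u, v, u - v ∉ {-1, -2, -3, …}`. -/
def gbinom (u v : ℂ) : ℂ :=
  Complex.Gamma (u + 1) / (Complex.Gamma (v + 1) * Complex.Gamma (u - v + 1))

open scoped Classical in
/-- The reciprocal of the parametric central binomial coefficient `binom (2s) s`, for `s ∉ ℤ`.
By convention it is zero when `2s` is a negative integer (then `s` is a half-integer, and
`Γ(2s+1)` has a pole). -/
def invCentralBinom (s : ℂ) : ℂ :=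
  if ∃ k : ℕ, 2 * s = -((k : ℂ) + 1) then 0 else (gbinom (2 * s) s)⁻¹

/-- The `n`-th term `4^(n+a) / ((n+a)^q binom(2n+2a, n+a)) * z^n` of the cyclotomic parametric
Apéry-like series. -/
def aperyTerm (q : ℕ) (a z : ℂ) (n : ℤ) : ℂ :=
  (4 : ℂ) ^ ((n : ℂ) + a) / ((n : ℂ) + a) ^ q * invCentralBinom ((n : ℂ) + a) * z ^ n

/-- The terms of the cyclotomic Hurwitz zeta series
`Li_p(x; c) = ∑_{m ≥ 1} x^m / (m + c - 1)^p`, indexed by `n = m - 1 ≥ 0`. -/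
def hurwitzTerm (p : ℕ) (x c : ℂ) (n : ℕ) : ℂ :=
  x ^ (n + 1) / ((n : ℂ) + c) ^ p

/-- The cyclotomic Hurwitz zeta function `Li_p(x; c)`, the limit of the partial sums of its
(possibly only conditionally convergent) series. -/
def cyclotomicLi (p : ℕ) (x c : ℂ) : ℂ :=
  ∑'[SummationFilter.conditional ℕ] n, hurwitzTerm p x c n

end CPAS

end

namespace CPAS

open Filter Topology Finset

/-! Write `b k` for `invSqrtCoeff k`. By Legendre duplication, `4 ^ s / (s * binom (2s) s)` is the
beta value `B(s, 1/2)`, which has the partial fractions `∑ b k / (k + s)`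
(`four_cpow_div_mul_invCentralBinom`, `betaHalf_eq_Gamma`). Formally, putting `m = n + k`, the
bilateral series factors as `(∑ₖ b k * x ^ k) * (∑ₘ x ^ (-m) / (m + a))`. The first factor is `(1 -
x) ^ (-1/2)`; splitting the second at `m = 0` gives the two `Li_1` values.

The double series is not absolutely convergent, so the interchange is made after summation by parts
in `n`. This replaces `1 / (m + a)` by the summable `1 / ((m + a) * (m + 1 + a))`, with boundary
terms that vanish because `betaHalf (n + a)` tends to `0` (`exists_norm_betaHalf_le`). For finite `M
≤ N` the result is one sum over `m`, weighted by partial sums of the binomial series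
(`sum_Icc_betaHalf_mul_zpow`). These are bounded on the unit circle away from `1`, so dominated
convergence gives the limit. -/

/-! ### The binomial series of `(1 - z) ^ (-1/2)` on the closed unit disc. -/

/-- The Taylor coefficients `binom (2k) k / 4 ^ k` of `(1 - z) ^ (-1 / 2)`. -/
noncomputable def invSqrtCoeff (k : ℕ) : ℝ := (k.centralBinom : ℝ) / 4 ^ k

theorem invSqrtCoeff_zero : invSqrtCoeff 0 = 1 := by simp [invSqrtCoeff]

theorem invSqrtCoeff_succ (k : ℕ) :
    ((k : ℝ) + 1) * invSqrtCoeff (k + 1) = (k + 1 / 2) * invSqrtCoeff k := by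
  have h : ((k : ℝ) + 1) * ((k + 1).centralBinom : ℝ) = 2 * (2 * k + 1) * k.centralBinom := by
    exact_mod_cast Nat.succ_mul_centralBinom_succ k
  rw [invSqrtCoeff, invSqrtCoeff, ← mul_div_assoc, h, pow_succ]
  field_simp
  ring

theorem invSqrtCoeff_pos (k : ℕ) : 0 < invSqrtCoeff k := by
  have := k.centralBinom_pos
  unfold invSqrtCoeff
  positivity

theorem invSqrtCoeff_antitone : Antitone invSqrtCoeff := by
  refine antitone_nat_of_succ_le fun k => ?_
  have h := invSqrtCoeff_succ k
  have := invSqrtCoeff_pos k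
  have hk : (0 : ℝ) ≤ k := k.cast_nonneg
  nlinarith

/-- The induction step reduces to `(k + 1/2)² (k + 2) ≤ (k + 1)³`. -/
theorem invSqrtCoeff_sq_le (k : ℕ) : invSqrtCoeff k ^ 2 * (k + 1) ≤ 1 := by
  induction k with
  | zero => simp [invSqrtCoeff_zero]
  | succ k ih =>
    have hk : (0 : ℝ) ≤ k := k.cast_nonneg
    have h : invSqrtCoeff (k + 1) = (k + 1 / 2) * invSqrtCoeff k / (k + 1) := by
      rw [← invSqrtCoeff_succ]
      field_simp
    refine le_trans ?_ ih
    rw [h, div_pow, div_mul_eq_mul_div, div_le_iff₀ (by positivity)]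
    push_cast
    have h2 : (0 : ℝ) ≤ invSqrtCoeff k ^ 2 := sq_nonneg _
    have h3 : ((k : ℝ) + 1 / 2) ^ 2 * (k + 1 + 1) ≤ (k + 1) * (k + 1) ^ 2 := by nlinarith
    calc _ = invSqrtCoeff k ^ 2 * (((k : ℝ) + 1 / 2) ^ 2 * (k + 1 + 1)) := by ring
      _ ≤ invSqrtCoeff k ^ 2 * ((k + 1) * (k + 1) ^ 2) := by gcongr
      _ = _ := by ring

theorem invSqrtCoeff_le (k : ℕ) : invSqrtCoeff k ≤ ((k : ℝ) + 1) ^ (-(1 / 2) : ℝ) := by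
  have hk : (0 : ℝ) < k + 1 := by positivity
  rw [Real.rpow_neg hk.le, ← Real.sqrt_eq_rpow, ← Real.sqrt_inv]
  refine Real.le_sqrt_of_sq_le ?_
  rw [← one_div, le_div_iff₀ hk]
  exact invSqrtCoeff_sq_le k

theorem tendsto_invSqrtCoeff : Tendsto invSqrtCoeff atTop (𝓝 0) := by
  refine squeeze_zero (fun k => (invSqrtCoeff_pos k).le) invSqrtCoeff_le ?_
  exact (tendsto_rpow_neg_atTop (by norm_num : (0 : ℝ) < 1 / 2)).comp
    (tendsto_atTop_add_const_right _ _ tendsto_natCast_atTop_atTop)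

theorem choose_half_eq_invSqrtCoeff (k : ℕ) :
    Ring.choose ((1 / 2 : ℂ) + k - 1) k = (invSqrtCoeff k : ℂ) := by
  rw [← Ring.multichoose_eq]
  have key : ∀ k : ℕ, (ascPochhammer ℂ k).eval (1 / 2 : ℂ) = k.factorial * invSqrtCoeff k := by
    intro k
    induction k with
    | zero => simp [invSqrtCoeff_zero]
    | succ k ih =>
      have h : ((k : ℂ) + 1) * invSqrtCoeff (k + 1) = (k + 1 / 2) * invSqrtCoeff k := by
        have := congrArg Complex.ofReal (invSqrtCoeff_succ k)
        push_cast at this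
        exact this
      rw [ascPochhammer_succ_eval, ih, Nat.factorial_succ]
      push_cast
      linear_combination -(k.factorial : ℂ) * h
  have h := Ring.factorial_nsmul_multichoose_eq_ascPochhammer (1 / 2 : ℂ) k
  rw [Polynomial.ascPochhammer_smeval_eq_eval, key, nsmul_eq_mul] at h
  exact mul_left_cancel₀ (by exact_mod_cast k.factorial_ne_zero) h

theorem hasSum_invSqrtCoeff_mul_pow {z : ℂ} (hz : ‖z‖ < 1) :
    HasSum (fun k : ℕ => (invSqrtCoeff k : ℂ) * z ^ k) ((1 - z) ^ (-(1 / 2) : ℂ)) := by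
  have h := (Complex.one_div_one_sub_cpow_hasFPowerSeriesOnBall_zero (1 / 2)).hasSum
    (y := z) (by simpa [enorm_eq_nnnorm, ← NNReal.coe_lt_coe] using hz)
  simp only [FormalMultilinearSeries.ofScalars_apply_eq, zero_add, smul_eq_mul,
    choose_half_eq_invSqrtCoeff] at h
  rwa [Complex.cpow_neg, ← one_div]

theorem norm_sum_pow_le {z : ℂ} (hz : ‖z‖ = 1) (hz1 : z ≠ 1) (n : ℕ) :
    ‖∑ i ∈ range n, z ^ i‖ ≤ 2 / ‖z - 1‖ := by
  rw [geom_sum_eq hz1, norm_div]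
  gcongr
  calc _ ≤ ‖z ^ n‖ + ‖(1 : ℂ)‖ := norm_sub_le _ _
    _ = 2 := by rw [norm_pow, hz]; norm_num

/-- Dirichlet's test gives convergence, and Abel's limit theorem identifies the limit with the
radial limit of the power function. Since `Re (1 - z) > 0`, the branch cut is avoided. -/
theorem tendsto_sum_invSqrtCoeff_mul_pow {z : ℂ} (hz : ‖z‖ = 1) (hz1 : z ≠ 1) :
    Tendsto (fun n : ℕ => ∑ k ∈ range n, (invSqrtCoeff k : ℂ) * z ^ k) atTop
      (𝓝 ((1 - z) ^ (-(1 / 2) : ℂ))) := by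
  obtain ⟨l, hl⟩ := cauchySeq_tendsto_of_complete
    (invSqrtCoeff_antitone.cauchySeq_series_mul_of_tendsto_zero_of_bounded
      tendsto_invSqrtCoeff (norm_sum_pow_le hz hz1))
  simp only [Complex.real_smul] at hl
  have h1 := Complex.tendsto_tsum_powerSeries_nhdsWithin_lt hl
  rw [tendsto_map'_iff] at h1
  have hre : 0 < (1 - z).re := by
    have h := Complex.normSq_eq_norm_sq z
    rw [hz, Complex.normSq_apply] at h
    simp only [Complex.sub_re, Complex.one_re]
    by_contra hcon
    have hre1 : z.re = 1 := by nlinarith [mul_self_nonneg z.im]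
    have him : z.im = 0 := by nlinarith [mul_self_nonneg z.im]
    exact hz1 (Complex.ext hre1 him)
  have h2 : Tendsto (fun r : ℝ => (1 - z * r) ^ (-(1 / 2) : ℂ)) (𝓝[<] 1)
      (𝓝 ((1 - z) ^ (-(1 / 2) : ℂ))) := by
    have hc : ContinuousAt (fun r : ℝ => (1 - z * r) ^ (-(1 / 2) : ℂ)) 1 := by
      refine ContinuousAt.cpow (by fun_prop) continuousAt_const ?_
      left
      simpa using hre
    have := hc.tendsto.mono_left (nhdsWithin_le_nhds (s := Set.Iio 1))
    simpa using this
  have h3 : l = (1 - z) ^ (-(1 / 2) : ℂ) := by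
    refine tendsto_nhds_unique (h1.congr' ?_) h2
    filter_upwards [Ioo_mem_nhdsLT (show (0 : ℝ) < 1 by norm_num)] with r hr
    have hn : ‖z * r‖ < 1 := by
      rw [norm_mul, hz, one_mul, Complex.norm_real, Real.norm_of_nonneg hr.1.le]
      exact hr.2
    rw [← (hasSum_invSqrtCoeff_mul_pow hn).tsum_eq]
    simp [mul_pow, mul_assoc]
  rwa [← h3]

theorem exists_norm_sum_invSqrtCoeff_mul_pow_le {z : ℂ} (hz : ‖z‖ = 1) (hz1 : z ≠ 1) :
    ∃ C, ∀ n : ℕ, ‖∑ k ∈ range n, (invSqrtCoeff k : ℂ) * z ^ k‖ ≤ C := by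
  obtain ⟨C, hC⟩ := (tendsto_sum_invSqrtCoeff_mul_pow hz hz1).norm.bddAbove_range
  exact ⟨C, fun n => hC ⟨n, rfl⟩⟩

/-! ### Decay estimates for `1 / (m + s)` and for the partial fraction series. -/

theorem exists_one_add_abs_le_mul_norm (s : ℂ) :
    ∃ C : ℝ, 0 < C ∧ ∀ m : ℤ, (m : ℂ) + s ≠ 0 → 1 + |(m : ℝ)| ≤ C * ‖(m : ℂ) + s‖ := by
  set K : ℤ := ⌈2 * ‖s‖ + 1⌉ with hK
  -- The constant `2` serves `|m| ≥ 2‖s‖ + 1`, where `1 + |m| ≤ 2 (|m| - ‖s‖)`; the sum absorbs the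
  -- finitely many other `m`.
  refine ⟨2 + ∑ m ∈ Icc (-K) K, (1 + |(m : ℝ)|) / ‖(m : ℂ) + s‖, ?_, fun m hm => ?_⟩
  · exact add_pos_of_pos_of_nonneg two_pos (sum_nonneg fun m _ => by positivity)
  have hpos : 0 < ‖(m : ℂ) + s‖ := norm_pos_iff.mpr hm
  have hsum : 0 ≤ ∑ m ∈ Icc (-K) K, (1 + |(m : ℝ)|) / ‖(m : ℂ) + s‖ :=
    sum_nonneg fun m _ => by positivity
  rw [← div_le_iff₀ hpos]
  by_cases hmK : m ∈ Icc (-K) K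
  · have := single_le_sum (f := fun m : ℤ => (1 + |(m : ℝ)|) / ‖(m : ℂ) + s‖)
      (fun m _ => by positivity) hmK
    linarith
  · have hlt : K < |m| := by
      by_contra hcon
      exact hmK (mem_Icc.mpr (abs_le.mp (not_lt.mp hcon)))
    have h1 : 2 * ‖s‖ + 1 ≤ |(m : ℝ)| := by
      refine (Int.le_ceil _).trans ?_
      rw [← hK]
      exact_mod_cast hlt.le
    have h2 : |(m : ℝ)| - ‖s‖ ≤ ‖(m : ℂ) + s‖ := by
      have := norm_sub_norm_le (m : ℂ) (-s)
      simpa using this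
    rw [div_le_iff₀ hpos]
    nlinarith

theorem exists_norm_inv_add_le (s : ℂ) :
    ∃ C : ℝ, 0 < C ∧ ∀ m : ℤ, ‖((m : ℂ) + s)⁻¹‖ ≤ C * (1 + |(m : ℝ)|)⁻¹ := by
  obtain ⟨C, hC, h⟩ := exists_one_add_abs_le_mul_norm s
  refine ⟨C, hC, fun m => ?_⟩
  by_cases hm : (m : ℂ) + s = 0
  · rw [hm, inv_zero, norm_zero]
    positivity
  · rw [norm_inv, ← div_eq_mul_inv, le_div_iff₀ (by positivity), inv_mul_le_iff₀
      (norm_pos_iff.mpr hm), mul_comm]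
    exact h m hm

theorem summable_one_add_abs_rpow {p : ℝ} (hp : 1 < p) :
    Summable fun m : ℤ => (1 + |(m : ℝ)|) ^ (-p) := by
  refine Summable.of_norm_bounded_eventually (Real.summable_abs_int_rpow hp) ?_
  filter_upwards [(Set.finite_singleton (0 : ℤ)).compl_mem_cofinite] with m hm
  have hm0 : (0 : ℝ) < |(m : ℝ)| := by
    rw [abs_pos]
    exact_mod_cast hm
  rw [Real.norm_of_nonneg (by positivity)]
  exact Real.rpow_le_rpow_of_nonpos hm0 (by linarith) (by linarith)

/-- The larger of `u`, `v` is at least their mean, so a quarter power of it can be given up for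
decay in the mean. The remaining exponent `5/4` is still summable. -/
theorem rpow_mul_inv_le {u v : ℝ} (hu : 0 < u) (hv : 0 < v) :
    u ^ (-(1 / 2) : ℝ) * v⁻¹ ≤
      ((u + v) / 2) ^ (-(1 / 4) : ℝ) * (u ^ (-(5 / 4) : ℝ) + v ^ (-(5 / 4) : ℝ)) := by
  have hm : 0 < (u + v) / 2 := by positivity
  rcases le_total v u with h | h
  · have h1 : u ^ (-(1 / 4) : ℝ) ≤ ((u + v) / 2) ^ (-(1 / 4) : ℝ) :=
      Real.rpow_le_rpow_of_nonpos hm (by linarith) (by norm_num)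
    have h2 : u ^ (-(1 / 4) : ℝ) ≤ v ^ (-(1 / 4) : ℝ) :=
      Real.rpow_le_rpow_of_nonpos hv h (by norm_num)
    calc u ^ (-(1 / 2) : ℝ) * v⁻¹ = u ^ (-(1 / 4) : ℝ) * (u ^ (-(1 / 4) : ℝ) * v⁻¹) := by
          rw [← mul_assoc, ← Real.rpow_add hu]; norm_num
      _ ≤ ((u + v) / 2) ^ (-(1 / 4) : ℝ) * (v ^ (-(1 / 4) : ℝ) * v⁻¹) := by gcongr
      _ = ((u + v) / 2) ^ (-(1 / 4) : ℝ) * v ^ (-(5 / 4) : ℝ) := by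
          rw [← Real.rpow_neg_one v, ← Real.rpow_add hv]; norm_num
      _ ≤ _ := by
          gcongr
          exact le_add_of_nonneg_left (by positivity)
  · have h1 : v ^ (-(1 / 4) : ℝ) ≤ ((u + v) / 2) ^ (-(1 / 4) : ℝ) :=
      Real.rpow_le_rpow_of_nonpos hm (by linarith) (by norm_num)
    have h2 : v ^ (-(3 / 4) : ℝ) ≤ u ^ (-(3 / 4) : ℝ) :=
      Real.rpow_le_rpow_of_nonpos hu h (by norm_num)
    calc u ^ (-(1 / 2) : ℝ) * v⁻¹ = v ^ (-(1 / 4) : ℝ) * (u ^ (-(1 / 2) : ℝ) * v ^ (-(3 / 4) : ℝ)) := by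
          rw [mul_left_comm, ← Real.rpow_add hv, ← Real.rpow_neg_one v]; norm_num
      _ ≤ ((u + v) / 2) ^ (-(1 / 4) : ℝ) * (u ^ (-(1 / 2) : ℝ) * u ^ (-(3 / 4) : ℝ)) := by gcongr
      _ = ((u + v) / 2) ^ (-(1 / 4) : ℝ) * u ^ (-(5 / 4) : ℝ) := by
          rw [← Real.rpow_add hu]; norm_num
      _ ≤ _ := by
          gcongr
          exact le_add_of_nonneg_right (by positivity)

theorem summable_invSqrtCoeff_div (s : ℂ) :
    Summable fun k : ℕ => (invSqrtCoeff k : ℂ) / ((k : ℂ) + s) := by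
  obtain ⟨C, hC, h⟩ := exists_norm_inv_add_le s
  have hs : Summable fun k : ℕ => C * (1 + |((k : ℤ) : ℝ)|) ^ (-(3 / 2) : ℝ) :=
    ((summable_one_add_abs_rpow (p := 3 / 2) (by norm_num)).comp_injective
      Nat.cast_injective).mul_left C
  refine Summable.of_norm_bounded hs fun k => ?_
  have hk := h k
  simp only [Int.cast_natCast, Nat.abs_cast] at hk ⊢
  have hk0 : (0 : ℝ) < 1 + k := by positivity
  rw [div_eq_mul_inv, norm_mul, Complex.norm_real, Real.norm_of_nonneg (invSqrtCoeff_pos k).le]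
  calc _ ≤ ((k : ℝ) + 1) ^ (-(1 / 2) : ℝ) * (C * (1 + (k : ℝ))⁻¹) := by
        gcongr
        exact invSqrtCoeff_le k
    _ = C * ((1 + (k : ℝ)) ^ (-(1 / 2) : ℝ) * (1 + (k : ℝ)) ^ (-1 : ℝ)) := by
        rw [Real.rpow_neg_one, add_comm (k : ℝ) 1]; ring
    _ = _ := by rw [← Real.rpow_add hk0]; norm_num

/-- The partial fraction series `∑ₖ binom (2k) k / 4 ^ k / (k + s)` of `B(s, 1/2)`. -/
noncomputable def betaHalf (s : ℂ) : ℂ := ∑' k : ℕ, (invSqrtCoeff k : ℂ) / ((k : ℂ) + s)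

/-- `rpow_mul_inv_le` is applied with `u = 1 + |k|` and `v = 1 + |n + k|`, for which `u + v ≥ 1 +
|n|`. -/
theorem exists_norm_betaHalf_le (a : ℂ) :
    ∃ C : ℝ, ∀ n : ℤ, ‖betaHalf (n + a)‖ ≤ C * ((1 + |(n : ℝ)|) / 2) ^ (-(1 / 4) : ℝ) := by
  obtain ⟨C, hC, h⟩ := exists_norm_inv_add_le a
  have hZ := summable_one_add_abs_rpow (p := 5 / 4) (by norm_num)
  set S := ∑' m : ℤ, (1 + |(m : ℝ)|) ^ (-(5 / 4) : ℝ)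
  refine ⟨C * (S + S), fun n => ?_⟩
  have inj : Function.Injective fun k : ℕ => (k : ℤ) := Nat.cast_injective
  have inj' : Function.Injective fun k : ℕ => n + (k : ℤ) :=
    fun i j hij => by simpa using hij
  have nn : ∀ m : ℤ, 0 ≤ (1 + |(m : ℝ)|) ^ (-(5 / 4) : ℝ) := fun m => by positivity
  have h1 := hZ.comp_injective inj
  have h2 := hZ.comp_injective inj'
  have hle1 : ∑' k : ℕ, (1 + |((k : ℤ) : ℝ)|) ^ (-(5 / 4) : ℝ) ≤ S :=
    tsum_comp_le_tsum_of_inj hZ nn inj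
  have hle2 : ∑' k : ℕ, (1 + |((n + (k : ℤ) : ℤ) : ℝ)|) ^ (-(5 / 4) : ℝ) ≤ S :=
    tsum_comp_le_tsum_of_inj hZ nn inj'
  have hb := (h1.hasSum.add h2.hasSum).mul_left (C * ((1 + |(n : ℝ)|) / 2) ^ (-(1 / 4) : ℝ))
  refine (tsum_of_norm_bounded hb fun k => ?_).trans ?_
  · have hk := h (n + k)
    simp only [Function.comp_apply]
    set u : ℝ := 1 + |((k : ℤ) : ℝ)| with hu
    set v : ℝ := 1 + |((n + (k : ℤ) : ℤ) : ℝ)| with hv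
    have hu0 : 0 < u := by positivity
    have hv0 : 0 < v := by positivity
    have huk : (k : ℝ) + 1 = u := by rw [hu]; simp [add_comm]
    have huv : 1 + |(n : ℝ)| ≤ u + v := by
      have := abs_sub ((n + (k : ℤ) : ℤ) : ℝ) ((k : ℤ) : ℝ)
      push_cast at this hv hu
      rw [add_sub_cancel_right] at this
      rw [hu, hv]
      linarith
    have heq : (k : ℂ) + (n + a) = ((n + (k : ℤ) : ℤ) : ℂ) + a := by push_cast; ring
    rw [heq, div_eq_mul_inv, norm_mul, Complex.norm_real,
      Real.norm_of_nonneg (invSqrtCoeff_pos k).le]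
    calc _ ≤ u ^ (-(1 / 2) : ℝ) * (C * v⁻¹) := by
          gcongr
          rw [← huk]
          exact invSqrtCoeff_le k
      _ = C * (u ^ (-(1 / 2) : ℝ) * v⁻¹) := by ring
      _ ≤ C * (((u + v) / 2) ^ (-(1 / 4) : ℝ) * (u ^ (-(5 / 4) : ℝ) + v ^ (-(5 / 4) : ℝ))) :=
          mul_le_mul_of_nonneg_left (rpow_mul_inv_le hu0 hv0) hC.le
      _ ≤ C * (((1 + |(n : ℝ)|) / 2) ^ (-(1 / 4) : ℝ) *
            (u ^ (-(5 / 4) : ℝ) + v ^ (-(5 / 4) : ℝ))) := by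
          have := Real.rpow_le_rpow_of_nonpos (x := (1 + |(n : ℝ)|) / 2) (y := (u + v) / 2)
            (z := -(1 / 4)) (by positivity) (by linarith) (by norm_num)
          gcongr
      _ = _ := by ring
  · rw [mul_right_comm]
    simp only [Function.comp_apply]
    gcongr

theorem tendsto_betaHalf_zero {l : Filter ℤ} (a : ℂ)
    (hl : Tendsto (fun n : ℤ => |(n : ℝ)|) l atTop) :
    Tendsto (fun n : ℤ => betaHalf (n + a)) l (𝓝 0) := by
  obtain ⟨C, hC⟩ := exists_norm_betaHalf_le a
  refine squeeze_zero_norm hC ?_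
  rw [← mul_zero C]
  refine Tendsto.const_mul C ((tendsto_rpow_neg_atTop (by norm_num : (0 : ℝ) < 1 / 4)).comp ?_)
  exact (tendsto_atTop_add_const_left _ 1 hl).atTop_div_const two_pos

/-! ### Identification of the partial fraction series with the Apéry-like coefficient. -/

theorem betaHalf_recurrence {s : ℂ} (hs : ∀ m : ℕ, s ≠ -m) :
    (s + 1 / 2) * betaHalf (s + 1) = s * betaHalf s := by
  have hne : ∀ k : ℕ, (k : ℂ) + s ≠ 0 := fun k hk => hs k (by linear_combination hk)
  have hsub : HasSum (fun k : ℕ => (s + 1 / 2) * ((invSqrtCoeff k : ℂ) / (k + (s + 1))) -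
      s * ((invSqrtCoeff k : ℂ) / (k + s)))
      ((s + 1 / 2) * betaHalf (s + 1) - s * betaHalf s) :=
    ((summable_invSqrtCoeff_div (s + 1)).hasSum.mul_left _).sub
      ((summable_invSqrtCoeff_div s).hasSum.mul_left _)
  -- By the recurrence for the coefficients, the `k`-th term of the difference is `t k - t (k + 1)`,
  -- so the series telescopes; `t 0 = 0` and `t n → 0`.
  set t : ℕ → ℂ := fun k => (invSqrtCoeff k : ℂ) * (k / (k + s)) with ht
  have hb : Tendsto (fun k : ℕ => (invSqrtCoeff k : ℂ)) atTop (𝓝 0) := by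
    have := (Complex.continuous_ofReal.tendsto 0).comp tendsto_invSqrtCoeff
    rwa [Complex.ofReal_zero] at this
  have ht0 : Tendsto t atTop (𝓝 0) := by
    have h0 : Tendsto (fun k : ℕ => s * ((invSqrtCoeff k : ℂ) / (k + s))) atTop (𝓝 0) := by
      simpa using (summable_invSqrtCoeff_div s).tendsto_atTop_zero.const_mul s
    have := hb.sub h0
    rw [sub_zero] at this
    refine this.congr fun k => ?_
    have := hne k
    simp only [ht]
    field_simp
    ring
  have hpart : ∀ n : ℕ, ∑ k ∈ range n, ((s + 1 / 2) * ((invSqrtCoeff k : ℂ) / (k + (s + 1))) -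
      s * ((invSqrtCoeff k : ℂ) / (k + s))) = t 0 - t n := by
    intro n
    rw [← sum_range_sub']
    refine sum_congr rfl fun k _ => ?_
    have h1 := hne k
    have h2 := hne (k + 1)
    have h3 : (k : ℂ) + (s + 1) ≠ 0 := by
      intro h
      exact h2 (by push_cast; linear_combination h)
    have hr : ((k : ℂ) + 1) * invSqrtCoeff (k + 1) = (k + 1 / 2) * invSqrtCoeff k := by
      have := congrArg Complex.ofReal (invSqrtCoeff_succ k)
      push_cast at this
      exact this
    have h4 : t (k + 1) = (k + 1 / 2) * invSqrtCoeff k / (k + (s + 1)) := by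
      simp only [ht]
      rw [← hr]
      push_cast
      rw [show (k : ℂ) + 1 + s = k + (s + 1) by ring]
      ring
    rw [h4]
    simp only [ht]
    field_simp
    ring
  have hlim := hsub.tendsto_sum_nat
  simp only [hpart] at hlim
  have h0 : Tendsto (fun n => t 0 - t n) atTop (𝓝 0) := by
    have : t 0 = 0 := by simp [ht]
    simpa [this] using ht0.neg
  exact sub_eq_zero.mp (tendsto_nhds_unique hlim h0)

/-- Expand `(1 - t) ^ (-1/2)` in the beta integral and integrate termwise. -/
theorem betaHalf_of_re_pos {s : ℂ} (hs : 0 < s.re) :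
    betaHalf s = Complex.betaIntegral s (1 / 2) := by
  have hcpow : ∀ k : ℕ, ∀ t ∈ Set.Ioc (0 : ℝ) 1,
      (t : ℂ) ^ (s - 1) * ((invSqrtCoeff k : ℂ) * (t : ℂ) ^ k) =
        invSqrtCoeff k * (t : ℂ) ^ (k + s - 1) := by
    intro k t ht
    have ht0 : (t : ℂ) ≠ 0 := by exact_mod_cast ht.1.ne'
    rw [show (k : ℂ) + s - 1 = (s - 1) + k by ring, Complex.cpow_add _ _ ht0, Complex.cpow_natCast]
    ring
  have hre : ∀ k : ℕ, -1 < ((k : ℂ) + s - 1).re := by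
    intro k
    have : (0 : ℝ) ≤ k := k.cast_nonneg
    simp
    linarith
  have hint : ∀ k : ℕ, MeasureTheory.Integrable
      (fun t : ℝ => (t : ℂ) ^ (s - 1) * ((invSqrtCoeff k : ℂ) * (t : ℂ) ^ k))
      (MeasureTheory.volume.restrict (Set.Ioc 0 1)) := by
    intro k
    have h := (intervalIntegral.intervalIntegrable_cpow' (a := 0) (b := 1) (hre k)).const_mul
      (invSqrtCoeff k : ℂ)
    rw [intervalIntegrable_iff_integrableOn_Ioc_of_le zero_le_one] at h
    exact h.congr_fun (fun t ht => (hcpow k t ht).symm) measurableSet_Ioc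
  have hnorm : ∀ k : ℕ, ∫ t in Set.Ioc (0 : ℝ) 1,
      ‖(t : ℂ) ^ (s - 1) * ((invSqrtCoeff k : ℂ) * (t : ℂ) ^ k)‖ =
        invSqrtCoeff k / (k + s.re) := by
    intro k
    have hk : (0 : ℝ) ≤ k := k.cast_nonneg
    have : ∀ t ∈ Set.Ioc (0 : ℝ) 1,
        ‖(t : ℂ) ^ (s - 1) * ((invSqrtCoeff k : ℂ) * (t : ℂ) ^ k)‖ =
          invSqrtCoeff k * t ^ (k + s.re - 1) := by
      intro t ht
      rw [hcpow k t ht, norm_mul, Complex.norm_real, Real.norm_of_nonneg (invSqrtCoeff_pos k).le,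
        Complex.norm_cpow_eq_rpow_re_of_pos ht.1]
      simp
    rw [MeasureTheory.setIntegral_congr_fun measurableSet_Ioc this,
      MeasureTheory.integral_const_mul, ← intervalIntegral.integral_of_le zero_le_one,
      integral_rpow (Or.inl (by linarith)), sub_add_cancel, Real.one_rpow,
      Real.zero_rpow (by positivity), sub_zero, mul_one_div]
  have hsummable : Summable fun k : ℕ => ∫ t in Set.Ioc (0 : ℝ) 1,
      ‖(t : ℂ) ^ (s - 1) * ((invSqrtCoeff k : ℂ) * (t : ℂ) ^ k)‖ := by
    simp only [hnorm]
    have h := (summable_invSqrtCoeff_div (s.re : ℂ)).norm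
    refine h.congr fun k => ?_
    rw [← Complex.ofReal_natCast, ← Complex.ofReal_add, ← Complex.ofReal_div, Complex.norm_real,
      Real.norm_of_nonneg]
    have := (invSqrtCoeff_pos k).le
    positivity
  have hsum := MeasureTheory.hasSum_integral_of_summable_integral_norm hint hsummable
  have hval : ∀ k : ℕ, ∫ t in Set.Ioc (0 : ℝ) 1,
      (t : ℂ) ^ (s - 1) * ((invSqrtCoeff k : ℂ) * (t : ℂ) ^ k) =
        (invSqrtCoeff k : ℂ) / (k + s) := by
    intro k
    have hks : (k : ℂ) + s ≠ 0 := by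
      intro h
      have := congrArg Complex.re h
      have hk : (0 : ℝ) ≤ k := k.cast_nonneg
      simp at this
      linarith
    rw [MeasureTheory.setIntegral_congr_fun measurableSet_Ioc (hcpow k),
      MeasureTheory.integral_const_mul, ← intervalIntegral.integral_of_le zero_le_one,
      integral_cpow (Or.inl (hre k)), sub_add_cancel]
    simp [Complex.zero_cpow hks, div_eq_mul_inv]
  simp only [hval] at hsum
  rw [betaHalf, hsum.tsum_eq, Complex.betaIntegral, intervalIntegral.integral_of_le zero_le_one,
    MeasureTheory.integral_Ioc_eq_integral_Ioo, MeasureTheory.integral_Ioc_eq_integral_Ioo]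
  refine MeasureTheory.setIntegral_congr_fun measurableSet_Ioo fun t ht => ?_
  have htn : ‖(t : ℂ)‖ < 1 := by
    rw [Complex.norm_real, Real.norm_of_nonneg ht.1.le]
    exact ht.2
  rw [tsum_mul_left, (hasSum_invSqrtCoeff_mul_pow htn).tsum_eq]
  norm_num

/-- Both sides obey the same recurrence, which carries the identity leftwards from `Re s > 0` one
unit at a time. -/
theorem betaHalf_eq_Gamma {s : ℂ} (hs : ∀ m : ℕ, s ≠ -m) :
    betaHalf s = (√Real.pi : ℝ) * Complex.Gamma s / Complex.Gamma (s + 1 / 2) := by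
  have key : ∀ n : ℕ, ∀ s : ℂ, (∀ m : ℕ, s ≠ -m) → 0 < s.re + n →
      betaHalf s = (√Real.pi : ℝ) * Complex.Gamma s / Complex.Gamma (s + 1 / 2) := by
    intro n
    induction n with
    | zero =>
      intro s _ hre
      have hre' : 0 < s.re := by simpa using hre
      rw [betaHalf_of_re_pos hre', Complex.betaIntegral_eq_Gamma_mul_div _ _ hre' (by norm_num),
        Complex.Gamma_one_half_eq, Real.sqrt_eq_rpow, Complex.ofReal_cpow Real.pi_pos.le]
      push_cast
      ring
    | succ n ih =>
      intro s hs hre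
      have hs0 : s ≠ 0 := by simpa using hs 0
      have hs1 : ∀ m : ℕ, s + 1 ≠ -m := fun m h => hs (m + 1) (by push_cast; linear_combination h)
      have h1 := ih (s + 1) hs1 (by push_cast at hre; simp; linarith)
      have hrec := betaHalf_recurrence hs
      rw [h1, Complex.Gamma_add_one s hs0] at hrec
      -- The functional equation for `1 / Γ` needs no exclusion of poles, so half-integers `s` are
      -- covered.
      have hG := Complex.one_div_Gamma_eq_self_mul_one_div_Gamma_add_one (s + 1 / 2)
      apply mul_left_cancel₀ hs0
      rw [← hrec, div_eq_mul_inv _ (Complex.Gamma (s + 1 / 2)), hG,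
        show s + 1 + 1 / 2 = s + 1 / 2 + 1 by ring]
      ring
  obtain ⟨n, hn⟩ := exists_nat_gt (-s.re)
  exact key n s hs (by linarith)

theorem four_cpow_div_mul_invCentralBinom {s : ℂ} (hs : ∀ k : ℤ, s ≠ k) :
    (4 : ℂ) ^ s / s * invCentralBinom s = betaHalf s := by
  have hs0 : s ≠ 0 := by simpa using hs 0
  have hsn : ∀ m : ℕ, s ≠ -m := fun m h => hs (-m) (by rw [h]; push_cast; ring)
  rw [betaHalf_eq_Gamma hsn, invCentralBinom]
  split_ifs with h
  -- For even `k`, `s + 1/2` is a pole of `Γ`, where `Complex.Gamma` has value `0`, so the quotient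
  -- is `0` as the convention demands. Odd `k` would make `s` an integer.
  · obtain ⟨k, hk⟩ := h
    rcases Nat.even_or_odd' k with ⟨j, rfl | rfl⟩
    · rw [show s + 1 / 2 = -(j : ℂ) by push_cast at hk; linear_combination hk / 2,
        Complex.Gamma_neg_nat_eq_zero]
      simp
    · exact absurd (by push_cast at hk ⊢; linear_combination hk / 2) (hs (-(j + 1 : ℤ)))
  · have h2s : ∀ m : ℕ, 2 * s ≠ -m := by
      intro m hm
      cases m with
      | zero => simp [hs0] at hm
      | succ k => exact h ⟨k, by rw [hm]; push_cast; ring⟩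
    have hG := Complex.Gamma_ne_zero hsn
    have hG2 := Complex.Gamma_ne_zero h2s
    have h2 : (2 : ℂ) ^ s ≠ 0 := by simp [Complex.cpow_eq_zero_iff]
    have hpi : ((√Real.pi : ℝ) : ℂ) ≠ 0 := by
      exact_mod_cast (Real.sqrt_pos.mpr Real.pi_pos).ne'
    have h4 : (4 : ℂ) ^ s = 2 ^ s * 2 ^ s := by
      have := Complex.natCast_mul_natCast_cpow 2 2 s
      norm_num at this
      exact this
    have hL := Complex.Gamma_mul_Gamma_add_half s
    rw [Complex.cpow_sub _ _ two_ne_zero, Complex.cpow_one, two_mul s,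
      Complex.cpow_add _ _ two_ne_zero, ← two_mul s] at hL
    have hGh : Complex.Gamma (s + 1 / 2) =
        Complex.Gamma (2 * s) * (2 / (2 ^ s * 2 ^ s)) * (√Real.pi : ℝ) / Complex.Gamma s := by
      rw [← hL, mul_div_cancel_left₀ _ hG]
    rw [gbinom, hGh, show 2 * s - s + 1 = s + 1 by ring, Complex.Gamma_add_one s hs0,
      Complex.Gamma_add_one (2 * s) (mul_ne_zero two_ne_zero hs0), h4]
    field_simp

theorem aperyTerm_one_eq {a : ℂ} (ha : ∀ k : ℤ, a ≠ k) (z : ℂ) (n : ℤ) :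
    aperyTerm 1 a z n = betaHalf (n + a) * z ^ n := by
  rw [aperyTerm, pow_one, four_cpow_div_mul_invCentralBinom]
  intro k hk
  exact ha (k - n) (by push_cast; linear_combination hk)

/-! ### Conditional convergence of the Hurwitz series by summation by parts. -/

/-- The absolutely summable remainder left by summation by parts in `∑ z ^ m / (m + c)`. -/
noncomputable def hurwitzRemainder (z c : ℂ) (m : ℤ) : ℂ :=
  z ^ (m + 1) / ((z - 1) * ((m + c) * (m + (1 + c))))

theorem summable_hurwitzRemainder {z : ℂ} (hz : ‖z‖ = 1) (c : ℂ) :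
    Summable (hurwitzRemainder z c) := by
  obtain ⟨C, hC, h⟩ := exists_norm_inv_add_le c
  obtain ⟨D, hD, h'⟩ := exists_norm_inv_add_le (1 + c)
  have hs := (summable_one_add_abs_rpow (p := 2) (by norm_num)).mul_left (‖(z - 1)⁻¹‖ * (C * D))
  refine Summable.of_norm_bounded hs fun m => ?_
  have hm0 : (0 : ℝ) < 1 + |(m : ℝ)| := by positivity
  rw [hurwitzRemainder, div_eq_mul_inv, norm_mul, norm_zpow, hz, one_zpow, one_mul, mul_inv,
    mul_inv, norm_mul, norm_mul]
  calc _ ≤ ‖(z - 1)⁻¹‖ * ((C * (1 + |(m : ℝ)|)⁻¹) * (D * (1 + |(m : ℝ)|)⁻¹)) := by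
        gcongr
        · exact h m
        · exact h' m
    _ = ‖(z - 1)⁻¹‖ * (C * D) * ((1 + |(m : ℝ)|) ^ (-1 : ℝ) * (1 + |(m : ℝ)|) ^ (-1 : ℝ)) := by
        rw [Real.rpow_neg_one]; ring
    _ = _ := by rw [← Real.rpow_add hm0]; norm_num

theorem hasSum_conditional_pow_div {z c : ℂ} (hz : ‖z‖ = 1) (hz1 : z ≠ 1)
    (hc : ∀ m : ℕ, c ≠ -m) :
    HasSum (fun n : ℕ => z ^ n / (n + c))
      (∑' n : ℕ, hurwitzRemainder z c n - 1 / ((z - 1) * c)) (SummationFilter.conditional ℕ) := by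
  have hne : ∀ k : ℕ, (k : ℂ) + c ≠ 0 := fun k hk => hc k (by linear_combination hk)
  have hz1' : z - 1 ≠ 0 := sub_ne_zero.mpr hz1
  -- The telescoping part of the summation by parts; `-w 0` is the boundary constant in the sum.
  set w : ℕ → ℂ := fun n => z ^ n / ((z - 1) * (n + c)) with hw
  have hstep : ∀ n : ℕ, z ^ n / (n + c) = hurwitzRemainder z c n + (w (n + 1) - w n) := by
    intro n
    have h1 := hne n
    have h2 := hne (n + 1)
    push_cast at h2
    have h3 : (n : ℂ) + (1 + c) ≠ 0 := by rwa [← add_assoc]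
    simp only [hw, hurwitzRemainder]
    rw [show ((n : ℤ) + 1) = ((n + 1 : ℕ) : ℤ) by push_cast; rfl, zpow_natCast]
    push_cast
    rw [add_assoc (n : ℂ) 1 c]
    field_simp
    ring
  have hw0 : Tendsto w atTop (𝓝 0) := by
    obtain ⟨C, hC, h⟩ := exists_norm_inv_add_le c
    have hlim : Tendsto (fun n : ℕ => ‖(z - 1)⁻¹‖ * (C * (1 + (n : ℝ))⁻¹)) atTop (𝓝 0) := by
      have := ((tendsto_atTop_add_const_left _ (1 : ℝ)
        tendsto_natCast_atTop_atTop).inv_tendsto_atTop.const_mul C).const_mul ‖(z - 1)⁻¹‖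
      simpa using this
    refine squeeze_zero_norm (fun n => ?_) hlim
    have hn := h n
    simp only [Int.cast_natCast, Nat.abs_cast] at hn
    simp only [hw]
    rw [div_eq_mul_inv, norm_mul, norm_pow, hz, one_pow, one_mul, mul_inv, norm_mul]
    gcongr
  have hsumm := (summable_hurwitzRemainder hz c).comp_injective
    (i := fun n : ℕ => (n : ℤ)) Nat.cast_injective
  rw [HasSum, SummationFilter.conditional_filter_eq_map_range, tendsto_map'_iff]
  have hlim := hsumm.hasSum.tendsto_sum_nat.add (hw0.sub_const (w 0))
  have h0 : w 0 = 1 / ((z - 1) * c) := by simp [hw]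
  rw [zero_sub, h0, ← sub_eq_add_neg] at hlim
  refine hlim.congr fun n => ?_
  simp only [Function.comp_apply, hstep]
  rw [sum_add_distrib, sum_range_sub, h0]

/-- The first series covers `m ≥ 0`, and the second, under `m = -(n + 2)`, covers `m ≤ -2`. The two
boundary constants combine into the missing term `m = -1`. -/
theorem tsum_hurwitzRemainder_eq {x a : ℂ} (hx : ‖x‖ = 1) (hx1 : x ≠ 1)
    (ha : ∀ k : ℤ, a ≠ k) :
    (∑' n : ℕ, hurwitzRemainder x⁻¹ a n - 1 / ((x⁻¹ - 1) * a)) -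
      x * (∑' n : ℕ, hurwitzRemainder x (1 - a) n - 1 / ((x - 1) * (1 - a))) =
    ∑' m : ℤ, hurwitzRemainder x⁻¹ a m := by
  have hx0 : x ≠ 0 := by
    rintro rfl
    simp at hx
  have hxi : ‖x⁻¹‖ = 1 := by rw [norm_inv, hx, inv_one]
  have hsZ := summable_hurwitzRemainder hxi a
  have hs1 := hsZ.comp_injective (i := fun n : ℕ => (n : ℤ)) Nat.cast_injective
  have hs2 : Summable fun n : ℕ => hurwitzRemainder x⁻¹ a (-((n : ℤ) + 1)) :=
    hsZ.comp_injective (i := fun n : ℕ => -((n : ℤ) + 1)) (fun i j hij => by simpa using hij)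
  have ha0 : a ≠ 0 := by simpa using ha 0
  have ha1 : 1 - a ≠ 0 := sub_ne_zero.mpr (by simpa using (ha 1).symm)
  have hx1' : x - 1 ≠ 0 := sub_ne_zero.mpr hx1
  have hx1'' : 1 - x ≠ 0 := sub_ne_zero.mpr hx1.symm
  have hxx : x⁻¹ - 1 = (1 - x) / x := by field_simp
  rw [tsum_of_nat_of_neg_add_one hs1 hs2, hs2.tsum_eq_zero_add]
  have hterm : ∀ n : ℕ, hurwitzRemainder x⁻¹ a (-(((n + 1 : ℕ) : ℤ) + 1)) =
      -x * hurwitzRemainder x (1 - a) n := by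
    intro n
    have h1 : (n : ℂ) + (1 - a) ≠ 0 := fun h => ha (n + 1) (by push_cast; linear_combination -h)
    have h2 : (n : ℂ) + (1 + (1 - a)) ≠ 0 :=
      fun h => ha (n + 2) (by push_cast; linear_combination -h)
    rw [hurwitzRemainder, hurwitzRemainder, hxx,
      show (-(((n + 1 : ℕ) : ℤ) + 1) + 1) = -((n : ℤ) + 1) by push_cast; ring, inv_zpow, zpow_neg,
      inv_inv]
    push_cast
    rw [show -((n : ℂ) + 1 + 1) + a = -(n + (1 + (1 - a))) by ring,
      show -((n : ℂ) + 1 + 1) + (1 + a) = -(n + (1 - a)) by ring,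
      show 1 - x = -(x - 1) by ring]
    field_simp
  have hterm0 : hurwitzRemainder x⁻¹ a (-(((0 : ℕ) : ℤ) + 1)) =
      x / ((1 - x) * ((a - 1) * a)) := by
    rw [hurwitzRemainder, hxx]
    simp only [Nat.cast_zero, zero_add, neg_add_cancel, zpow_zero, Int.cast_neg, Int.cast_one,
      neg_add_cancel_left]
    rw [neg_add_eq_sub]
    have : a - 1 ≠ 0 := by rw [← neg_sub]; exact neg_ne_zero.mpr ha1
    field_simp
  simp only [hterm]
  rw [hterm0, tsum_mul_left, hxx, show x - 1 = -(1 - x) by ring, show a - 1 = -(1 - a) by ring]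
  field_simp
  ring

/-! ### Summation by parts in the bilateral series and passage to the limit. -/

theorem sum_Icc_int_sub (g : ℤ → ℂ) {M N : ℤ} (h : M ≤ N) :
    ∑ n ∈ Icc M N, (g (n + 1) - g n) = g (N + 1) - g M := by
  induction N, h using Int.leInduction with
  | base => simp
  | succ N hN ih =>
    rw [show Icc M (N + 1) = insert (N + 1) (Icc M N) by ext; simp; omega,
      sum_insert (by simp), ih]
    ring

/-- Partial sums `∑_{k < j} binom (2k) k / 4 ^ k * x ^ k`, extended by zero to `j ≤ 0`. -/
noncomputable def invSqrtPartialSum (x : ℂ) (j : ℤ) : ℂ :=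
  ∑ k ∈ range j.toNat, (invSqrtCoeff k : ℂ) * x ^ k

theorem invSqrtPartialSum_of_nonpos (x : ℂ) {j : ℤ} (hj : j ≤ 0) : invSqrtPartialSum x j = 0 := by
  simp [invSqrtPartialSum, Int.toNat_of_nonpos hj]

theorem invSqrtPartialSum_succ_sub_natCast (x : ℂ) (k : ℕ) :
    invSqrtPartialSum x (k + 1) - invSqrtPartialSum x k = (invSqrtCoeff k : ℂ) * x ^ k := by
  rw [invSqrtPartialSum, invSqrtPartialSum, Int.toNat_natCast, Int.toNat_natCast_add_one,
    sum_range_succ]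
  ring

theorem tendsto_invSqrtPartialSum {x : ℂ} (hx : ‖x‖ = 1) (hx1 : x ≠ 1) :
    Tendsto (invSqrtPartialSum x) atTop (𝓝 ((1 - x) ^ (-(1 / 2) : ℂ))) := by
  refine (tendsto_sum_invSqrtCoeff_mul_pow hx hx1).comp ?_
  exact tendsto_atTop.mpr fun b => (eventually_ge_atTop (b : ℤ)).mono fun j hj => by omega

/-- Substituting `m = n + k` makes the remainder independent of `n`. Writing `b k * x ^ k` as an
increment of partial sums, zero for `m < n`, prepares the telescoping in `n` at fixed `m`. -/
theorem hasSum_betaHalf_sub {x a : ℂ} (hx0 : x ≠ 0) (hx1 : x ≠ 1) (ha : ∀ k : ℤ, a ≠ k) (n : ℤ) :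
    HasSum (fun m : ℤ => (invSqrtPartialSum x (m - n + 1) - invSqrtPartialSum x (m - n)) *
        hurwitzRemainder x⁻¹ a m)
      (x⁻¹ ^ (n + 1) / (x⁻¹ - 1) * (betaHalf (n + a) - betaHalf ((n + 1 : ℤ) + a))) := by
  have inj : Function.Injective fun k : ℕ => n + (k : ℤ) := fun i j hij => by simpa using hij
  refine (inj.hasSum_iff fun m hm => ?_).mp ?_
  · have hlt : m - n < 0 := by
      by_contra hcon
      exact hm ⟨(m - n).toNat, by simp only; omega⟩
    rw [invSqrtPartialSum_of_nonpos _ hlt.le, invSqrtPartialSum_of_nonpos _ (by omega)]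
    simp
  · have h := ((summable_invSqrtCoeff_div (n + a)).hasSum.sub
      (summable_invSqrtCoeff_div ((n + 1 : ℤ) + a)).hasSum).mul_left (x⁻¹ ^ (n + 1) / (x⁻¹ - 1))
    refine h.congr_fun fun k => ?_
    have h1 : (n : ℂ) + k + a ≠ 0 := fun h => ha (-(n + k)) (by push_cast; linear_combination h)
    have h2 : (n : ℂ) + k + (1 + a) ≠ 0 :=
      fun h => ha (-(n + k + 1)) (by push_cast; linear_combination h)
    simp only [Function.comp_apply, add_sub_cancel_left]
    have hz1 : x⁻¹ - 1 ≠ 0 := sub_ne_zero.mpr (inv_ne_one.mpr hx1)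
    have hpow : x⁻¹ ^ (n + (k : ℤ) + 1) = x⁻¹ ^ (n + 1) * (x ^ k)⁻¹ := by
      rw [add_right_comm, zpow_add₀ (inv_ne_zero hx0), zpow_natCast, inv_pow]
    rw [invSqrtPartialSum_succ_sub_natCast, hurwitzRemainder, hpow]
    push_cast
    rw [show (k : ℂ) + (n + a) = n + k + a by ring,
      show (k : ℂ) + (n + 1 + a) = n + k + (1 + a) by ring]
    have hxk := pow_ne_zero k hx0
    field_simp
    ring

theorem sum_Icc_betaHalf_mul_zpow {x a : ℂ} (hx0 : x ≠ 0) (hx1 : x ≠ 1) (ha : ∀ k : ℤ, a ≠ k)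
    {M N : ℤ} (h : M ≤ N) :
    ∑ n ∈ Icc M N, betaHalf (n + a) * x⁻¹ ^ n =
      (x⁻¹ ^ (N + 1) / (x⁻¹ - 1) * betaHalf ((N + 1 : ℤ) + a) -
        x⁻¹ ^ M / (x⁻¹ - 1) * betaHalf (M + a)) +
      ∑' m : ℤ, (invSqrtPartialSum x (m - M + 1) - invSqrtPartialSum x (m - N)) *
        hurwitzRemainder x⁻¹ a m := by
  have hz1 : x⁻¹ - 1 ≠ 0 := sub_ne_zero.mpr (inv_ne_one.mpr hx1)
  have hs := hasSum_sum fun n (_ : n ∈ Icc M N) => hasSum_betaHalf_sub hx0 hx1 ha n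
  have hQ : ∀ m : ℤ, ∑ n ∈ Icc M N,
      (invSqrtPartialSum x (m - n + 1) - invSqrtPartialSum x (m - n)) *
        hurwitzRemainder x⁻¹ a m =
      (invSqrtPartialSum x (m - M + 1) - invSqrtPartialSum x (m - N)) *
        hurwitzRemainder x⁻¹ a m := by
    intro m
    -- For fixed `m` the increments over `M ≤ n ≤ N` telescope to a difference of two partial sums.
    have ht := sum_Icc_int_sub (fun n => -invSqrtPartialSum x (m - n + 1)) h
    rw [← sum_mul]
    congr 1
    convert ht using 1
    · refine sum_congr rfl fun n _ => ?_
      rw [show m - (n + 1) + 1 = m - n by ring]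
      ring
    · rw [show m - (N + 1) + 1 = m - N by ring]
      ring
  simp only [hQ] at hs
  rw [hs.tsum_eq, ← sum_Icc_int_sub (fun n => x⁻¹ ^ n / (x⁻¹ - 1) * betaHalf (n + a)) h,
    ← sum_add_distrib]
  refine sum_congr rfl fun n _ => ?_
  rw [zpow_add_one₀ (inv_ne_zero hx0)]
  field_simp
  ring

theorem tendsto_boundary_term {x a : ℂ} (hx : ‖x‖ = 1) {l : Filter ℤ}
    (hl : Tendsto (fun n : ℤ => |(n : ℝ)|) l atTop) :
    Tendsto (fun n : ℤ => x⁻¹ ^ n / (x⁻¹ - 1) * betaHalf (n + a)) l (𝓝 0) := by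
  have h := ((tendsto_betaHalf_zero a hl).norm).const_mul ‖(x⁻¹ - 1)⁻¹‖
  rw [norm_zero, mul_zero] at h
  refine squeeze_zero_norm (fun n => le_of_eq ?_) h
  rw [div_eq_mul_inv, norm_mul, norm_mul, norm_zpow, norm_inv, hx]
  simp

/-- At fixed `m`, the first partial sum exhausts the binomial series as `M → -∞`, and the second is
empty once `N ≥ m`. Boundedness of partial sums supplies the dominating series. -/
theorem tendsto_tsum_invSqrtPartialSum_mul {x a : ℂ} (hx : ‖x‖ = 1) (hx1 : x ≠ 1) :
    Tendsto (fun p : ℤ × ℤ => ∑' m : ℤ,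
        (invSqrtPartialSum x (m - p.1 + 1) - invSqrtPartialSum x (m - p.2)) *
          hurwitzRemainder x⁻¹ a m) (atBot ×ˢ atTop)
      (𝓝 (∑' m : ℤ, (1 - x) ^ (-(1 / 2) : ℂ) * hurwitzRemainder x⁻¹ a m)) := by
  obtain ⟨C, hC⟩ := exists_norm_sum_invSqrtCoeff_mul_pow_le hx hx1
  have hxi : ‖x⁻¹‖ = 1 := by rw [norm_inv, hx, inv_one]
  refine tendsto_tsum_of_dominated_convergence
    ((summable_hurwitzRemainder hxi a).norm.mul_left (C + C)) (fun m => ?_)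
    (Eventually.of_forall fun p m => ?_)
  · refine Tendsto.mul_const _ ?_
    have h1 : Tendsto (fun p : ℤ × ℤ => invSqrtPartialSum x (m - p.1 + 1)) (atBot ×ˢ atTop)
        (𝓝 ((1 - x) ^ (-(1 / 2) : ℂ))) := by
      have hj : Tendsto (fun j : ℤ => m - j + 1) atBot atTop := tendsto_atTop.mpr fun b =>
        (eventually_le_atBot (m + 1 - b)).mono fun j hj => by omega
      exact ((tendsto_invSqrtPartialSum hx hx1).comp hj).comp tendsto_fst
    have h2 : Tendsto (fun p : ℤ × ℤ => invSqrtPartialSum x (m - p.2)) (atBot ×ˢ atTop)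
        (𝓝 0) := by
      refine tendsto_const_nhds.congr' ?_
      filter_upwards [tendsto_snd.eventually (eventually_ge_atTop m)] with p hp
      rw [invSqrtPartialSum_of_nonpos _ (by omega)]
    simpa using h1.sub h2
  · rw [norm_mul]
    gcongr
    exact (norm_sub_le _ _).trans (add_le_add (hC _) (hC _))

theorem hasSum_aperyTerm {x a : ℂ} (hx : ‖x‖ = 1) (hx1 : x ≠ 1) (ha : ∀ k : ℤ, a ≠ k) :
    HasSum (aperyTerm 1 a x⁻¹)
      ((∑' m : ℤ, hurwitzRemainder x⁻¹ a m) / Complex.sqrt (1 - x))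
      (SummationFilter.conditional ℤ) := by
  have hx0 : x ≠ 0 := by
    rintro rfl
    simp at hx
  have habs_top : Tendsto (fun n : ℤ => |(n : ℝ)|) atTop atTop :=
    tendsto_abs_atTop_atTop.comp tendsto_intCast_atTop_atTop
  have habs_bot : Tendsto (fun n : ℤ => |(n : ℝ)|) atBot atTop :=
    (tendsto_intCast_atTop_atTop.comp tendsto_abs_atBot_atTop).congr fun n => by simp
  have h1 := ((tendsto_boundary_term (a := a) hx habs_top).comp
    (tendsto_atTop_add_const_right _ (1 : ℤ) tendsto_id)).comp
    (tendsto_snd (f := (atBot : Filter ℤ)))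
  have h2 := (tendsto_boundary_term (a := a) hx habs_bot).comp
    (tendsto_fst (g := (atTop : Filter ℤ)))
  have h3 := (h1.sub h2).add (tendsto_tsum_invSqrtPartialSum_mul (a := a) hx hx1)
  rw [sub_zero, zero_add, tsum_mul_left, Complex.cpow_neg, ← div_eq_inv_mul, one_div,
    ← Complex.sqrt] at h3
  rw [HasSum, SummationFilter.conditional_filter, tendsto_map'_iff]
  refine h3.congr' ?_
  filter_upwards [prod_mem_prod (Iic_mem_atBot (0 : ℤ)) (Ici_mem_atTop (0 : ℤ))] with p hp
  have hle : p.1 ≤ p.2 := le_trans hp.1 hp.2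
  simp only [Function.comp_apply, aperyTerm_one_eq ha, id]
  rw [sum_Icc_betaHalf_mul_zpow hx0 hx1 ha hle]

end CPAS

/-- For `x ≠ 1` a root of unity and `a ∉ ℤ`, the two series `Li_1(x⁻¹; a)` and `Li_1(x; 1 - a)`
converge, and so does the bilateral series (its partial sums over `[M, N]` have a limit as
`M → -∞` and `N → ∞` independently), with the stated value. The square root is the principal
one. -/
theorem mainTheorem4 (x a : ℂ) (hx : ∃ N : ℕ, 0 < N ∧ x ^ N = 1) (hx1 : x ≠ 1)
    (ha : ∀ k : ℤ, a ≠ (k : ℂ)) :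
    Summable (CPAS.hurwitzTerm 1 x⁻¹ a) (SummationFilter.conditional ℕ) ∧
    Summable (CPAS.hurwitzTerm 1 x (1 - a)) (SummationFilter.conditional ℕ) ∧
    HasSum (CPAS.aperyTerm 1 a x⁻¹)
      ((x * CPAS.cyclotomicLi 1 x⁻¹ a - CPAS.cyclotomicLi 1 x (1 - a)) / Complex.sqrt (1 - x))
      (SummationFilter.conditional ℤ) := by
  obtain ⟨N, hN, hxN⟩ := hx
  have hxn : ‖x‖ = 1 := Complex.norm_eq_one_of_pow_eq_one hxN hN.ne'
  have hx0 : x ≠ 0 := by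
    rintro rfl
    simp at hxn
  have hxi : ‖x⁻¹‖ = 1 := by rw [norm_inv, hxn, inv_one]
  have hS1 : HasSum (CPAS.hurwitzTerm 1 x⁻¹ a) _ (SummationFilter.conditional ℕ) :=
    ((CPAS.hasSum_conditional_pow_div hxi (inv_ne_one.mpr hx1)
      (fun m h => ha (-m) (by push_cast; exact h))).mul_left x⁻¹).congr_fun fun n => by
        rw [CPAS.hurwitzTerm, pow_one, pow_succ]
        ring
  have hS2 : HasSum (CPAS.hurwitzTerm 1 x (1 - a)) _ (SummationFilter.conditional ℕ) :=
    ((CPAS.hasSum_conditional_pow_div (c := 1 - a) hxn hx1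
      (fun m h => ha (m + 1) (by push_cast; linear_combination -h))).mul_left x).congr_fun
      fun n => by
        rw [CPAS.hurwitzTerm, pow_one, pow_succ]
        ring
  refine ⟨hS1.summable, hS2.summable, ?_⟩
  -- The exponent `n + 1` in `hurwitzTerm` puts a factor `x⁻¹` in front of the first sum, which the
  -- factor `x` of the statement cancels.
  rw [CPAS.cyclotomicLi, CPAS.cyclotomicLi, hS1.tsum_eq, hS2.tsum_eq, mul_inv_cancel_left₀ hx0,
    CPAS.tsum_hurwitzRemainder_eq hxn hx1 ha]
  exact CPAS.hasSum_aperyTerm hxn hx1 ha
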